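/- Let $K$ be a field and $n\ge 1$. Let $G$ be a bipartite graph without isolated vertices on $V_n=W\cup W'$, $W=\{x_1,\dots,x_n\}$, $W'=\{y_1,\dots,y_n\}$ (every edge joins $W$ to $W'$), which is unmixed (all minimal vertex covers of $G$ have the same cardinality) and labelled so that $\{x_i,y_i\}\in E(G)$ for all $i$. Let $\mathcal L_G$ be the set, ordered by inclusion, of all $\alpha\subseteq\{p_1,\dots,p_n\}$ of the form $\alpha=\{p_k : x_k\in C\}$ with $C$ a minimal vertex cover of $G$; it is closed under union and intersection. Let $S=K[x_1,\dots,x_n,y_1,\dots,y_n]$, and let $A(G)\subseteq S[t]$ be the vertex cover algebra, i.e. the $K$-subalgebra generated by all monomials $x_1^{c_1}\cdots x_n^{c_n}y_1^{c_{n+1}}\cdots y_n^{c_{2n}}t^k$ with $k\in\mathbb N$ and $c\in\mathbb N^{2n}$ a $k$-vertex cover of $G$ (the exponents at the two ends of each edge sum to at least $k$). Let $B_G=K[x_1,\dots,x_n,y_1,\dots,y_n,\{u_\alpha\}_{\alpha\in\mathcal L_G}]$. The toric ideal $Q_G$ of $A(G)$ is the kernel of the surjective $K$-algebra homomorphism $\xi:B_G\to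 A(G)$ with $x_i\mapsto x_i$, $y_i\mapsto y_i$, $u_\alpha\mapsto m_\alpha t$, where $m_\alpha=\prod_{p_i\in\alpha}x_i\prod_{p_j\notin\alpha}y_j$. Fix any linear order of the variables $u_\alpha$ such that $u_\alpha>u_\beta$ whenever $\beta\subsetneq\alpha$. Let $<_{lex}^{\#}$ be the monomial order on $B_G$ that first compares the parts in the $x_i,y_j$ by the lexicographic order with $x_1>\dots>x_n>y_1>\dots>y_n$ and, if these are equal, compares the parts in the $u_\alpha$ by the (graded) reverse lexicographic order. **Theorem.** The reduced Gröbner basis of $Q_G$ with respect to $<_{lex}^{\#}$ is $$\{x_{\beta\setminus\alpha}u_\alpha-y_{\beta\setminus\alpha}u_\beta : \alpha\in\mathcal L_G,\ \alpha\ne\{p_1,\dots,p_n\},\ \beta\in V(\alpha)\}\ \cup\ \{u_\alpha u_\beta-u_{\alpha\cup\beta}u_{\alpha\cap\beta} : \alpha,\beta\in\mathcal L_G,\ \alpha\not\subset\beta,\ \beta\not\subset\alpha\},$$ where $V(\alpha)$ is the set of upper neighbours of $\alpha$ in $\mathcal L_G$ (the $\beta\in\mathcal L_G$ with $\alpha\subsetneq\beta$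 and no element of $\mathcal L_G$ strictly between), $x_{\beta\setminus\alpha}=\prod_{p_i\in\beta\setminus\alpha}x_i$ and $y_{\beta\setminus\alpha}=\prod_{p_i\in\beta\setminus\alpha}y_i$ (and $\alpha\not\subset\beta$ means that $\alpha$ is not a subset of $\beta$, equality included). Moreover, the initial monomial of each of these binomials is its first monomial. -/

import Mathlib

open scoped MonomialOrder

noncomputable section

namespace VertexCoverAlgebra

/-! ### Monomial orders -/

/-- The product of two monomial orders: exponents are first compared on the variables indexed
by `σ`, and ties are broken by comparing on the variables indexed by `τ`. -/
def prodOrder {σ τ : Type*} (m₁ : MonomialOrder σ) (m₂ : MonomialOrder τ) :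
    MonomialOrder (σ ⊕ τ) where
  syn := m₁.syn ×ₗ m₂.syn
  addCommMonoidSyn := inferInstance
  linearOrderSyn := inferInstance
  isOrderedAddMonoid_syn := inferInstance
  toSyn :=
    { toFun := fun a => toLex
        (m₁.toSyn (Finsupp.sumFinsuppAddEquivProdFinsupp a).1,
          m₂.toSyn (Finsupp.sumFinsuppAddEquivProdFinsupp a).2)
      invFun := fun b => Finsupp.sumFinsuppAddEquivProdFinsupp.symm
        (m₁.toSyn.symm (ofLex b).1, m₂.toSyn.symm (ofLex b).2)
      left_inv := fun a => by simp
      right_inv := fun b => by simp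
      map_add' := fun a b => by simp only [map_add, Prod.fst_add, Prod.snd_add]; rfl }
  toSyn_monotone := fun a b h => by
    refine Prod.Lex.toLex_mono (Prod.mk_le_mk.2 ⟨m₁.toSyn_monotone ?_, m₂.toSyn_monotone ?_⟩)
    · intro i; simpa using h (Sum.inl i)
    · intro i; simpa using h (Sum.inr i)
  wellFoundedLT_syn := inferInstance

theorem prodOrder_lt_iff {σ τ : Type*} (m₁ : MonomialOrder σ) (m₂ : MonomialOrder τ)
    (a b : σ ⊕ τ →₀ ℕ) :
    a ≺[prodOrder m₁ m₂] b ↔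
      (Finsupp.sumFinsuppAddEquivProdFinsupp a).1 ≺[m₁]
          (Finsupp.sumFinsuppAddEquivProdFinsupp b).1 ∨
        (Finsupp.sumFinsuppAddEquivProdFinsupp a).1 = (Finsupp.sumFinsuppAddEquivProdFinsupp b).1 ∧
          (Finsupp.sumFinsuppAddEquivProdFinsupp a).2 ≺[m₂]
            (Finsupp.sumFinsuppAddEquivProdFinsupp b).2 := by
  refine Prod.Lex.toLex_lt_toLex.trans (or_congr Iff.rfl (and_congr ?_ Iff.rfl))
  exact m₁.toSyn.injective.eq_iff

/-- Type synonym for exponent vectors, carrying the (graded) reverse lexicographic order. -/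
def RevLex (τ : Type*) : Type _ := τ →₀ ℕ

instance (τ : Type*) : AddCommMonoid (RevLex τ) := inferInstanceAs (AddCommMonoid (τ →₀ ℕ))

/-- The identity map to the type synonym. -/
def toRevLex {τ : Type*} : (τ →₀ ℕ) ≃+ RevLex τ := AddEquiv.refl (τ →₀ ℕ)

/-- The comparison key: first the total degree, then the reversed lexicographic comparison
starting with the smallest variable. -/
def revLexKey {τ : Type*} (a : τ →₀ ℕ) : ℕ ×ₗ (Lex (τ →₀ ℕ))ᵒᵈ :=
  toLex (Finsupp.degree a, OrderDual.toDual (toLex a))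

theorem revLexKey_add {τ : Type*} (a b : τ →₀ ℕ) :
    revLexKey (a + b) = revLexKey a + revLexKey b := by
  unfold revLexKey
  rw [map_add]
  rfl

instance (τ : Type*) [LinearOrder τ] : LinearOrder (RevLex τ) :=
  LinearOrder.lift' (fun a : RevLex τ => revLexKey (toRevLex.symm a)) (fun a b h => by
    have h2 := congrArg (fun z => ofLex (OrderDual.ofDual (ofLex z).2)) h
    exact toRevLex.symm.injective h2)

theorem RevLex.le_iff {τ : Type*} [LinearOrder τ] (a b : RevLex τ) :
    a ≤ b ↔ revLexKey (toRevLex.symm a) ≤ revLexKey (toRevLex.symm b) := Iff.rfl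

theorem RevLex.lt_iff {τ : Type*} [LinearOrder τ] (a b : RevLex τ) :
    a < b ↔ revLexKey (toRevLex.symm a) < revLexKey (toRevLex.symm b) := Iff.rfl

instance (τ : Type*) [LinearOrder τ] : IsOrderedAddMonoid (RevLex τ) where
  add_le_add_left a b h c := by
    rw [RevLex.le_iff] at h ⊢
    rw [map_add, map_add, revLexKey_add, revLexKey_add]
    gcongr

theorem toRevLex_monotone {τ : Type*} [LinearOrder τ] :
    Monotone (toRevLex : (τ →₀ ℕ) ≃+ RevLex τ) := by
  intro a b h
  obtain ⟨c, rfl⟩ := exists_add_of_le h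
  rw [RevLex.le_iff, AddEquiv.symm_apply_apply, AddEquiv.symm_apply_apply]
  unfold revLexKey
  rw [Prod.Lex.toLex_le_toLex]
  by_cases hc : c = 0
  · subst hc; right; simp
  · left
    rw [map_add]
    have : Finsupp.degree c ≠ 0 := by rwa [Ne, Finsupp.degree_eq_zero_iff]
    omega

/-- The reverse lexicographic monomial order on finitely many variables, where the linear order
on the index type `τ` is the order of the variables. -/
def revLex (τ : Type*) [Finite τ] [LinearOrder τ] : MonomialOrder τ where
  syn := RevLex τ
  toSyn := toRevLex
  toSyn_monotone := toRevLex_monotone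
  wellFoundedLT_syn := by
    have := Monotone.wellQuasiOrderedLE_of_wellQuasiOrderedLE_of_surjective
      (toRevLex_monotone (τ := τ)) toRevLex.surjective
    infer_instance

/-- `a` is smaller than `b` iff the degree of `a` is smaller than that of `b`, or the degrees agree
and, for the smallest variable at which the exponents differ, the exponent in `a` is the larger
one. -/
theorem revLex_lt_iff {τ : Type*} [Finite τ] [LinearOrder τ] (a b : τ →₀ ℕ) :
    a ≺[revLex τ] b ↔ a.degree < b.degree ∨
      a.degree = b.degree ∧ ∃ i, (∀ j < i, a j = b j) ∧ b i < a i := by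
  refine (RevLex.lt_iff _ _).trans (Prod.Lex.toLex_lt_toLex.trans ?_)
  refine or_congr Iff.rfl (and_congr Iff.rfl ?_)
  refine OrderDual.toDual_lt_toDual.trans (Finsupp.Lex.lt_iff.trans ?_)
  exact exists_congr fun i => and_congr (forall₂_congr fun j _ => eq_comm) Iff.rfl

/-- The lexicographic order induced by `x₁ > ⋯ > xₙ > y₁ > ⋯ > yₙ`, where `Sum.inl i` is the index
of `xᵢ` and `Sum.inr i` is that of `yᵢ`. In `MonomialOrder.lex` the variables with *smaller* index
are the *larger* ones. -/
def lexXY (n : ℕ) : MonomialOrder (Fin n ⊕ Fin n) :=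
  @MonomialOrder.lex (Fin n ⊕ Fin n) (inferInstanceAs (LinearOrder (Fin n ⊕ₗ Fin n)))
    (inferInstanceAs (WellFoundedGT (Fin n ⊕ₗ Fin n)))

theorem lexXY_lt_iff {n : ℕ} (a b : Fin n ⊕ Fin n →₀ ℕ) :
    a ≺[lexXY n] b ↔
      (∃ i : Fin n, (∀ j < i, a (Sum.inl j) = b (Sum.inl j)) ∧ a (Sum.inl i) < b (Sum.inl i)) ∨
        (∀ j : Fin n, a (Sum.inl j) = b (Sum.inl j)) ∧
          ∃ i : Fin n, (∀ j < i, a (Sum.inr j) = b (Sum.inr j)) ∧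
            a (Sum.inr i) < b (Sum.inr i) := by
  have key : a ≺[lexXY n] b ↔
      ∃ i : Fin n ⊕ₗ Fin n, (∀ j < i, a (ofLex j) = b (ofLex j)) ∧ a (ofLex i) < b (ofLex i) :=
    Iff.rfl
  rw [key]
  constructor
  · rintro ⟨i, h1, h2⟩
    rcases i with i | i
    · exact Or.inl ⟨i, fun j hj => h1 (Sum.inlₗ j) (Sum.Lex.inl_lt_inl_iff.2 hj), h2⟩
    · exact Or.inr ⟨fun j => h1 (Sum.inlₗ j) (Sum.Lex.inl_lt_inr _ _), i,
        fun j hj => h1 (Sum.inrₗ j) (Sum.Lex.inr_lt_inr_iff.2 hj), h2⟩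
  · rintro (⟨i, h1, h2⟩ | ⟨h0, i, h1, h2⟩)
    · refine ⟨Sum.inlₗ i, fun j hj => ?_, h2⟩
      rcases j with j | j
      · exact h1 j (Sum.Lex.inl_lt_inl_iff.1 hj)
      · exact absurd hj Sum.Lex.not_inr_lt_inl
    · refine ⟨Sum.inrₗ i, fun j hj => ?_, h2⟩
      rcases j with j | j
      · exact h0 j
      · exact h1 j (Sum.Lex.inr_lt_inr_iff.1 hj)

/-! ### Reduced Gröbner bases -/

/-- `B` is a reduced Gröbner basis of the ideal `I`: a finite subset of `I` whose initial terms
generate the initial ideal of `I`, consisting of polynomials with leading coefficient `1`, and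
such that no monomial of an element of `B` is divisible by the initial monomial of another
element of `B`. -/
structure IsReducedGroebnerBasis {σ K : Type*} [Field K] (m : MonomialOrder σ)
    (I : Ideal (MvPolynomial σ K)) (B : Set (MvPolynomial σ K)) : Prop where
  finite : B.Finite
  subset : B ⊆ I
  span_leadingTerm : Ideal.span (m.leadingTerm '' B) =
    Ideal.span (m.leadingTerm '' (I : Set (MvPolynomial σ K)))
  monic : ∀ g ∈ B, m.Monic g
  reduced : ∀ g ∈ B, ∀ h ∈ B, h ≠ g → ∀ c ∈ g.support, ¬ m.degree h ≤ c

/-! ### Unmixed bipartite graphs and their lattices -/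

variable {n : ℕ}

/-- A graph on `{x₁, …, xₙ} ∪ {y₁, …, yₙ}` (`xᵢ` is `Sum.inl i` and `yᵢ` is `Sum.inr i`) that is
bipartite with respect to these two sets, without isolated vertices, unmixed (all minimal vertex
covers have the same cardinality), and labelled so that each `{xᵢ, yᵢ}` is an edge. -/
structure IsUnmixedBipartite (G : SimpleGraph (Fin n ⊕ Fin n)) : Prop where
  bipartite : G.IsBipartiteWith (Set.range Sum.inl) (Set.range Sum.inr)
  no_isolated : ∀ v, ¬ G.IsIsolated v
  unmixed : ∀ C D : Set (Fin n ⊕ Fin n),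
    Minimal G.IsVertexCover C → Minimal G.IsVertexCover D → C.ncard = D.ncard
  matching : ∀ i : Fin n, G.Adj (Sum.inl i) (Sum.inr i)

/-- The lattice `L_G`: the sets `{i | xᵢ ∈ C}` for `C` a minimal vertex cover of `G`. -/
def coverLattice (G : SimpleGraph (Fin n ⊕ Fin n)) : Set (Finset (Fin n)) :=
  {α | ∃ C : Set (Fin n ⊕ Fin n), Minimal G.IsVertexCover C ∧ ∀ k, k ∈ α ↔ Sum.inl k ∈ C}

/-- The upper neighbours of `α` in `L_G`: the elements covering `α` with respect to inclusion. -/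
def upperNeighbours {G : SimpleGraph (Fin n ⊕ Fin n)} (α : coverLattice G) :
    Set (coverLattice G) :=
  {β | α ⋖ β}

theorem IsUnmixedBipartite.cover_iff {G : SimpleGraph (Fin n ⊕ Fin n)}
    (hG : IsUnmixedBipartite G) (C : Set (Fin n ⊕ Fin n)) :
    G.IsVertexCover C ↔
      ∀ i j, G.Adj (Sum.inl i) (Sum.inr j) → Sum.inl i ∈ C ∨ Sum.inr j ∈ C := by
  refine ⟨fun h i j hij => h hij, fun h v w hvw => ?_⟩
  rcases hG.bipartite.mem_of_adj hvw with ⟨⟨i, rfl⟩, ⟨j, rfl⟩⟩ | ⟨⟨i, rfl⟩, ⟨j, rfl⟩⟩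
  · exact h i j hvw
  · exact (h j i hvw.symm).symm

/-- A vertex cover containing at most one of `xᵢ`, `yᵢ` for each `i` is minimal. -/
theorem IsUnmixedBipartite.minimal_of_disjoint {G : SimpleGraph (Fin n ⊕ Fin n)}
    (hG : IsUnmixedBipartite G) {C : Set (Fin n ⊕ Fin n)} (hC : G.IsVertexCover C)
    (h : ∀ i, ¬ (Sum.inl i ∈ C ∧ Sum.inr i ∈ C)) : Minimal G.IsVertexCover C := by
  refine ⟨hC, fun D hD hDC v hv => ?_⟩
  rcases v with i | i
  · rcases hD (hG.matching i) with h1 | h1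
    · exact h1
    · exact absurd ⟨hv, hDC h1⟩ (h i)
  · rcases hD (hG.matching i) with h1 | h1
    · exact absurd ⟨hDC h1, hv⟩ (h i)
    · exact h1

/-- A minimal vertex cover contains exactly one of `xᵢ`, `yᵢ` for each `i`. -/
theorem IsUnmixedBipartite.inr_mem_iff {G : SimpleGraph (Fin n ⊕ Fin n)}
    (hG : IsUnmixedBipartite G) {C : Set (Fin n ⊕ Fin n)} (hC : Minimal G.IsVertexCover C)
    (i : Fin n) : Sum.inr i ∈ C ↔ Sum.inl i ∉ C := by
  classical
  have hW : Minimal G.IsVertexCover (Set.range (Sum.inl : Fin n → Fin n ⊕ Fin n)) :=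
    hG.minimal_of_disjoint ((hG.cover_iff _).2 fun i j _ => Or.inl ⟨i, rfl⟩) (by simp)
  have hcard : C.ncard = n := by
    rw [hG.unmixed C _ hC hW, ← Set.image_univ, Set.ncard_image_of_injective _ Sum.inl_injective]
    simp
  have hor : ∀ i, Sum.inl i ∈ C ∨ Sum.inr i ∈ C := fun i => hC.1 (hG.matching i)
  -- one representative of each pair already gives `n` elements
  let f : Fin n → Fin n ⊕ Fin n := fun j => if Sum.inl j ∈ C then Sum.inl j else Sum.inr j
  have hf : Function.Injective f := by
    intro a b hab
    simp only [f] at hab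
    split_ifs at hab <;> simpa using hab
  have hfC : Set.range f ⊆ C := by
    rintro _ ⟨j, rfl⟩
    simp only [f]
    split_ifs with h
    · exact h
    · exact (hor j).resolve_left h
  have heq : Set.range f = C := by
    refine Set.eq_of_subset_of_ncard_le hfC ?_ (Set.toFinite _)
    rw [hcard, ← Set.image_univ, Set.ncard_image_of_injective _ hf]
    simp
  refine ⟨fun h1 h2 => ?_, fun h => (hor i).resolve_left h⟩
  rw [← heq] at h1
  obtain ⟨j, hj⟩ := h1
  simp only [f] at hj
  split_ifs at hj with h3
  rw [Sum.inr.inj hj] at h3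
  exact h3 h2

/-- In an unmixed bipartite graph labelled as above, if `{xᵢ, yⱼ}` and `{xⱼ, yₖ}` are edges,
then so is `{xᵢ, yₖ}`. -/
theorem IsUnmixedBipartite.adj_trans {G : SimpleGraph (Fin n ⊕ Fin n)}
    (hG : IsUnmixedBipartite G) {i j k : Fin n} (hij : G.Adj (Sum.inl i) (Sum.inr j))
    (hjk : G.Adj (Sum.inl j) (Sum.inr k)) : G.Adj (Sum.inl i) (Sum.inr k) := by
  by_contra hik
  have hcov : G.IsVertexCover ({Sum.inl i, Sum.inr k}ᶜ : Set (Fin n ⊕ Fin n)) := by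
    rw [hG.cover_iff]
    intro a b hab
    by_contra h
    simp only [Set.mem_compl_iff, Set.mem_insert_iff, Set.mem_singleton_iff, not_or,
      not_not, reduceCtorEq, or_false, false_or, Sum.inl.injEq, Sum.inr.injEq] at h
    obtain ⟨rfl, rfl⟩ := h
    exact hik hab
  obtain ⟨C, hCle, hC⟩ := Finite.exists_le_minimal hcov
  have hi : Sum.inl i ∉ C := fun h => hCle h (by simp)
  have hk : Sum.inr k ∉ C := fun h => hCle h (by simp)
  exact (hG.inr_mem_iff hC j).1 ((hC.1 hij).resolve_left hi) ((hC.1 hjk).resolve_right hk)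

theorem IsUnmixedBipartite.mem_coverLattice {G : SimpleGraph (Fin n ⊕ Fin n)}
    (hG : IsUnmixedBipartite G) (α : Finset (Fin n)) :
    α ∈ coverLattice G ↔ ∀ i j, G.Adj (Sum.inl i) (Sum.inr j) → j ∈ α → i ∈ α := by
  constructor
  · rintro ⟨C, hC, hα⟩ i j hij hj
    by_contra hi
    rw [hα] at hi hj
    exact (hG.inr_mem_iff hC j).1 ((hC.1 hij).resolve_left hi) hj
  · intro h
    refine ⟨Sum.inl '' (α : Set (Fin n)) ∪ Sum.inr '' ((α : Set (Fin n))ᶜ), hG.minimal_of_disjoint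
      ((hG.cover_iff _).2 fun i j hij => ?_) ?_, fun k => by simp⟩
    · have := h i j hij
      by_cases hj : j ∈ α <;> simp_all
    · intro i
      simp

/-- The union of two elements of `L_G`, as an element of `L_G`. -/
def unionL {G : SimpleGraph (Fin n ⊕ Fin n)} (hG : IsUnmixedBipartite G) (α β : coverLattice G) :
    coverLattice G :=
  ⟨α.1 ∪ β.1, (hG.mem_coverLattice _).2 fun i j hij hj => by
    have h1 := (hG.mem_coverLattice _).1 α.2 i j hij
    have h2 := (hG.mem_coverLattice _).1 β.2 i j hij
    rw [Finset.mem_union] at hj ⊢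
    exact hj.imp h1 h2⟩

/-- The intersection of two elements of `L_G`, as an element of `L_G`. -/
def interL {G : SimpleGraph (Fin n ⊕ Fin n)} (hG : IsUnmixedBipartite G) (α β : coverLattice G) :
    coverLattice G :=
  ⟨α.1 ∩ β.1, (hG.mem_coverLattice _).2 fun i j hij hj => by
    have h1 := (hG.mem_coverLattice _).1 α.2 i j hij
    have h2 := (hG.mem_coverLattice _).1 β.2 i j hij
    rw [Finset.mem_inter] at hj ⊢
    exact ⟨h1 hj.1, h2 hj.2⟩⟩

/-! ### The vertex cover algebra and its toric ideal -/

/-- `c` is a `k`-vertex cover of `G`. -/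
def IsKCover {V : Type*} (G : SimpleGraph V) (k : ℕ) (c : V →₀ ℕ) : Prop :=
  ∀ ⦃v w : V⦄, G.Adj v w → k ≤ c v + c w

/-- The vertex cover algebra `A(G)`: the `K`-subalgebra of `K[V][t]` generated by the monomials
`z ^ c * t ^ k`, where `c` is a `k`-vertex cover of `G`. -/
def coverAlgebra (K : Type*) [Field K] {V : Type*} (G : SimpleGraph V) :
    Subalgebra K (Polynomial (MvPolynomial V K)) :=
  Algebra.adjoin K {f | ∃ (k : ℕ) (c : V →₀ ℕ), IsKCover G k c ∧
    f = Polynomial.monomial k (MvPolynomial.monomial c (1 : K))}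

/-- The exponent vector of `m_α`: `xᵢ` occurs for `i ∈ α` and `yᵢ` occurs for `i ∉ α`. -/
def coverExponent (α : Finset (Fin n)) : Fin n ⊕ Fin n →₀ ℕ :=
  ∑ i ∈ α, Finsupp.single (Sum.inl i) 1 + ∑ i ∈ αᶜ, Finsupp.single (Sum.inr i) 1

theorem coverExponent_inl (α : Finset (Fin n)) (i : Fin n) :
    coverExponent α (Sum.inl i) = if i ∈ α then 1 else 0 := by
  classical
  simp [coverExponent, Finsupp.single_apply]

theorem coverExponent_inr (α : Finset (Fin n)) (i : Fin n) :
    coverExponent α (Sum.inr i) = if i ∈ α then 0 else 1 := by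
  classical
  simp [coverExponent, Finsupp.single_apply]

theorem isKCover_coverExponent {G : SimpleGraph (Fin n ⊕ Fin n)} (hG : IsUnmixedBipartite G)
    (α : coverLattice G) : IsKCover G 1 (coverExponent α.1) := by
  intro v w hvw
  rcases hG.bipartite.mem_of_adj hvw with ⟨⟨i, rfl⟩, ⟨j, rfl⟩⟩ | ⟨⟨i, rfl⟩, ⟨j, rfl⟩⟩
  · have := (hG.mem_coverLattice _).1 α.2 i j hvw
    rw [coverExponent_inl, coverExponent_inr]
    split_ifs <;> first | omega | tauto
  · have := (hG.mem_coverLattice _).1 α.2 j i hvw.symm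
    rw [coverExponent_inl, coverExponent_inr]
    split_ifs <;> first | omega | tauto

/-- Every `(k + 1)`-vertex cover is the sum of some `m_α` and of a `k`-vertex cover. -/
theorem exists_isKCover_add {G : SimpleGraph (Fin n ⊕ Fin n)} (hG : IsUnmixedBipartite G)
    (k : ℕ) (c : Fin n ⊕ Fin n →₀ ℕ) (hc : IsKCover G (k + 1) c) :
    ∃ (α : coverLattice G) (d : Fin n ⊕ Fin n →₀ ℕ),
      IsKCover G k d ∧ c = coverExponent α.1 + d := by
  classical
  let α : Finset (Fin n) := Finset.univ.filter fun i =>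
    ∃ j, G.Adj (Sum.inl i) (Sum.inr j) ∧ c (Sum.inr j) = 0
  have hα : ∀ i, i ∈ α ↔ ∃ j, G.Adj (Sum.inl i) (Sum.inr j) ∧ c (Sum.inr j) = 0 := by
    intro i; simp [α]
  have hαL : α ∈ coverLattice G := by
    rw [hG.mem_coverLattice]
    intro i j hij hj
    rw [hα] at hj ⊢
    obtain ⟨l, hl, h0⟩ := hj
    exact ⟨l, hG.adj_trans hij hl, h0⟩
  have hx : ∀ i ∈ α, k + 1 ≤ c (Sum.inl i) := by
    intro i hi
    obtain ⟨l, hl, h0⟩ := (hα i).1 hi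
    have := hc hl
    omega
  have hy : ∀ i, i ∉ α → 1 ≤ c (Sum.inr i) := by
    intro i hi
    by_contra h
    exact hi ((hα i).2 ⟨i, hG.matching i, by omega⟩)
  have hle : coverExponent α ≤ c := by
    intro v
    rcases v with i | i
    · rw [coverExponent_inl]
      split_ifs with h
      · have := hx i h; omega
      · omega
    · rw [coverExponent_inr]
      split_ifs with h
      · omega
      · exact hy i h
  have hedge : ∀ i j, G.Adj (Sum.inl i) (Sum.inr j) →
      k ≤ (c - coverExponent α) (Sum.inl i) + (c - coverExponent α) (Sum.inr j) := by
    intro i j hij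
    have h0 := hc hij
    have h1 := hx i
    have h2 := hy j
    rw [Finsupp.tsub_apply, Finsupp.tsub_apply, coverExponent_inl, coverExponent_inr]
    clear_value α
    by_cases hi : i ∈ α <;> by_cases hj : j ∈ α <;> simp only [hi, hj, if_true, if_false]
    · have := h1 hi; omega
    · have := h1 hi; have := h2 hj; omega
    · omega
    · have := h2 hj; omega
  refine ⟨⟨α, hαL⟩, c - coverExponent α, fun v w hvw => ?_, (add_tsub_cancel_of_le hle).symm⟩
  rcases hG.bipartite.mem_of_adj hvw with ⟨⟨i, rfl⟩, ⟨j, rfl⟩⟩ | ⟨⟨i, rfl⟩, ⟨j, rfl⟩⟩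
  · exact hedge i j hvw
  · rw [add_comm]; exact hedge j i hvw.symm

/-- The variable `xᵢ` of `B_G`. -/
def varX (K : Type*) [Field K] (G : SimpleGraph (Fin n ⊕ Fin n)) (i : Fin n) :
    MvPolynomial ((Fin n ⊕ Fin n) ⊕ coverLattice G) K :=
  MvPolynomial.X (Sum.inl (Sum.inl i))

/-- The variable `yᵢ` of `B_G`. -/
def varY (K : Type*) [Field K] (G : SimpleGraph (Fin n ⊕ Fin n)) (i : Fin n) :
    MvPolynomial ((Fin n ⊕ Fin n) ⊕ coverLattice G) K :=
  MvPolynomial.X (Sum.inl (Sum.inr i))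

/-- The variable `u_α` of `B_G`. -/
def varU (K : Type*) [Field K] {G : SimpleGraph (Fin n ⊕ Fin n)} (α : coverLattice G) :
    MvPolynomial ((Fin n ⊕ Fin n) ⊕ coverLattice G) K :=
  MvPolynomial.X (Sum.inr α)

/-- The homomorphism `ξ : B_G → A(G)` with `xᵢ ↦ xᵢ`, `yᵢ ↦ yᵢ` and `u_α ↦ m_α * t`. -/
def toricMap (K : Type*) [Field K] {G : SimpleGraph (Fin n ⊕ Fin n)} (hG : IsUnmixedBipartite G) :
    MvPolynomial ((Fin n ⊕ Fin n) ⊕ coverLattice G) K →ₐ[K] coverAlgebra K G :=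
  MvPolynomial.aeval (Sum.elim
    (fun v => ⟨Polynomial.C (MvPolynomial.X v), Algebra.subset_adjoin
      ⟨0, Finsupp.single v 1, fun _ _ _ => Nat.zero_le _, rfl⟩⟩)
    (fun α => ⟨Polynomial.monomial 1 (MvPolynomial.monomial (coverExponent α.1) 1),
      Algebra.subset_adjoin ⟨1, coverExponent α.1, isKCover_coverExponent hG α, rfl⟩⟩))

/-- The homomorphism `ξ` is surjective. -/
theorem toricMap_surjective (K : Type*) [Field K] {G : SimpleGraph (Fin n ⊕ Fin n)}
    (hG : IsUnmixedBipartite G) : Function.Surjective (toricMap K hG) := by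
  let φ := (coverAlgebra K G).val.comp (toricMap K hG)
  have hv : ∀ v, φ (MvPolynomial.X (Sum.inl v)) = Polynomial.C (MvPolynomial.X v) := by
    intro v
    simp [φ, toricMap]
  have hu : ∀ α, φ (MvPolynomial.X (Sum.inr α)) =
      Polynomial.monomial 1 (MvPolynomial.monomial (coverExponent α.1) 1) := by
    intro α
    simp [φ, toricMap]
  have hC : ∀ p : MvPolynomial (Fin n ⊕ Fin n) K, Polynomial.C p ∈ φ.range := by
    intro p
    induction p using MvPolynomial.induction_on with
    | C a =>
      refine ⟨MvPolynomial.C a, ?_⟩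
      exact φ.commutes a
    | add p q hp hq => rw [map_add]; exact add_mem hp hq
    | mul_X p v hp => rw [map_mul]; exact mul_mem hp ⟨_, hv v⟩
  have hmon : ∀ (k : ℕ) (c : Fin n ⊕ Fin n →₀ ℕ), IsKCover G k c →
      Polynomial.monomial k (MvPolynomial.monomial c (1 : K)) ∈ φ.range := by
    intro k
    induction k with
    | zero => exact fun c _ => hC _
    | succ k ih =>
      intro c hc
      obtain ⟨α, d, hd, rfl⟩ := exists_isKCover_add hG k c hc
      have h := mul_mem (⟨_, hu α⟩ : _ ∈ φ.range) (ih d hd)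
      rwa [Polynomial.monomial_mul_monomial, MvPolynomial.monomial_mul, one_mul,
        add_comm 1 k] at h
  have hle : coverAlgebra K G ≤ φ.range := by
    refine Algebra.adjoin_le ?_
    rintro _ ⟨k, c, hc, rfl⟩
    exact hmon k c hc
  intro f
  obtain ⟨p, hp⟩ := hle f.2
  exact ⟨p, Subtype.ext hp⟩

/-- The toric ideal `Q_G` of `A(G)`. -/
def toricIdeal (K : Type*) [Field K] {G : SimpleGraph (Fin n ⊕ Fin n)}
    (hG : IsUnmixedBipartite G) : Ideal (MvPolynomial ((Fin n ⊕ Fin n) ⊕ coverLattice G) K) :=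
  RingHom.ker (toricMap K hG)

/-- The order `<_lex^♯` on `B_G`: the product of the lexicographic order on the `xᵢ`, `yᵢ` and of
the reverse lexicographic order on the `u_α`, for a given linear order of the variables `u_α`. -/
def lexSharp (G : SimpleGraph (Fin n ⊕ Fin n)) (o : LinearOrder (coverLattice G)) :
    MonomialOrder ((Fin n ⊕ Fin n) ⊕ coverLattice G) :=
  prodOrder (lexXY n) (@revLex (coverLattice G) inferInstance o)

/-- The monomial `x_{β∖α} * u_α`. -/
def xu (K : Type*) [Field K] {G : SimpleGraph (Fin n ⊕ Fin n)} (α β : coverLattice G) :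
    MvPolynomial ((Fin n ⊕ Fin n) ⊕ coverLattice G) K :=
  (∏ i ∈ β.1 \ α.1, varX K G i) * varU K α

/-- The monomial `y_{β∖α} * u_β`. -/
def yu (K : Type*) [Field K] {G : SimpleGraph (Fin n ⊕ Fin n)} (α β : coverLattice G) :
    MvPolynomial ((Fin n ⊕ Fin n) ⊕ coverLattice G) K :=
  (∏ i ∈ β.1 \ α.1, varY K G i) * varU K β

end VertexCoverAlgebra

end

namespace VertexCoverAlgebra

/-! ### Gröbner bases of ideals generated by fibres of a weight map -/

section Binomial

variable {σ K : Type*} [Field K] (m : MonomialOrder σ)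

/-! Since `ξ` sends monomials to monomials, the ring `B_G` is graded by `weight`, the exponent of
the image, and a polynomial lies in `Q_G` exactly when the coefficients in each weight sum to zero.
No S-pairs are needed. It suffices that the listed binomials join monomials of equal weight, that
their first monomials are the larger ones, and that distinct standard monomials (those divisible by
no first monomial) have distinct weights. The smallest monomial of a weight is always standard,
because otherwise a binomial would replace it by a smaller one. So if the initial monomial of some
nonzero `f ∈ Q_G` were standard, it would be the smallest of its weight. But it must cancel against
another monomial of `f` of the same weight, which is smaller still (`exists_move_le_degree`).

The core is `IsStandard.eq_of_weight_eq`, which reconstructs a standard monomial from its image. Its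
`u`-variables form a chain, and the top `u_μ` is determined by the image: were some `u_ν` with `ν ⊄
μ` to occur in another monomial with this image, then every `x_i` with `i ∈ ν \ μ` would divide the
image. No `u_α` with `α ⊆ μ` supplies such an `x_i`, so `x_{(μ ∪ ν) \ μ} u_μ` would divide the
standard monomial. Cancelling `u_μ` gives an induction on the degree in `t`.

Reducedness is a comparison of the variables that occur in the binomials (`eq_of_mem_moves_of_le`).
-/

theorem degree_binomial {a b : σ →₀ ℕ} (h : b ≺[m] a) :
    m.degree (MvPolynomial.monomial a (1 : K) - MvPolynomial.monomial b 1) = a := by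
  classical
  have ha : m.degree (MvPolynomial.monomial a (1 : K)) = a := by simp [m.degree_monomial]
  have hb : m.degree (MvPolynomial.monomial b (1 : K)) = b := by simp [m.degree_monomial]
  rw [m.degree_sub_of_lt (by rwa [ha, hb]), ha]

theorem monic_binomial {a b : σ →₀ ℕ} (h : b ≺[m] a) :
    m.Monic (MvPolynomial.monomial a (1 : K) - MvPolynomial.monomial b 1) := by
  classical
  rw [MonomialOrder.Monic, MonomialOrder.leadingCoeff, degree_binomial m h]
  have hne : b ≠ a := fun e => by rw [e] at h; exact lt_irrefl _ h
  simp [MvPolynomial.coeff_monomial, hne]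

theorem leadingTerm_binomial {a b : σ →₀ ℕ} (h : b ≺[m] a) :
    m.leadingTerm (MvPolynomial.monomial a (1 : K) - MvPolynomial.monomial b 1) =
      MvPolynomial.monomial a 1 := by
  rw [MonomialOrder.leadingTerm, degree_binomial m h, (monic_binomial m h).leadingCoeff_eq_one]

theorem mem_support_binomial {a b c : σ →₀ ℕ}
    (h : c ∈ (MvPolynomial.monomial a (1 : K) - MvPolynomial.monomial b 1).support) :
    c = a ∨ c = b := by
  classical
  by_contra! hc
  simp [MvPolynomial.coeff_monomial, hc.1.symm, hc.2.symm] at h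

/-- Initial terms of monic elements of `I` generate the initial ideal of `I` as soon as every
initial monomial is divisible by one of theirs. -/
theorem span_leadingTerm_eq {I : Ideal (MvPolynomial σ K)} {B : Set (MvPolynomial σ K)}
    (hB : B ⊆ I) (hmonic : ∀ g ∈ B, m.Monic g)
    (hdvd : ∀ f ∈ I, f ≠ 0 → ∃ g ∈ B, m.degree g ≤ m.degree f) :
    Ideal.span (m.leadingTerm '' B) =
      Ideal.span (m.leadingTerm '' (I : Set (MvPolynomial σ K))) := by
  refine le_antisymm (Ideal.span_mono (Set.image_mono hB)) (Ideal.span_le.2 ?_)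
  rintro _ ⟨f, hf, rfl⟩
  rcases eq_or_ne f 0 with rfl | h0
  · rw [m.leadingTerm_zero]; exact zero_mem _
  obtain ⟨g, hg, hle⟩ := hdvd f hf h0
  have : m.leadingTerm f =
      MvPolynomial.monomial (m.degree f - m.degree g) (m.leadingCoeff f) * m.leadingTerm g := by
    rw [MonomialOrder.leadingTerm, MonomialOrder.leadingTerm, (hmonic g hg).leadingCoeff_eq_one,
      MvPolynomial.monomial_mul, mul_one, tsub_add_cancel_of_le hle]
  rw [this]
  exact Ideal.mul_mem_left _ _ (Ideal.subset_span ⟨g, hg, rfl⟩)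

/-- If monomials which are not divisible by the initial exponent of any of the moves in `R` are
determined by their weight, then the initial monomial of a polynomial, each of whose monomials
shares its weight with another one, is divisible by the initial exponent of a move. -/
theorem exists_move_le_degree {M : Type*} [AddCommMonoid M] (wt : (σ →₀ ℕ) →+ M)
    {R : Set ((σ →₀ ℕ) × (σ →₀ ℕ))} (hlt : ∀ p ∈ R, p.2 ≺[m] p.1)
    (hwt : ∀ p ∈ R, wt p.1 = wt p.2)
    (hinj : ∀ c d, (∀ p ∈ R, ¬ p.1 ≤ c) → (∀ p ∈ R, ¬ p.1 ≤ d) → wt c = wt d → c = d)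
    {f : MvPolynomial σ K} (hf : f ≠ 0)
    (hfib : ∀ c ∈ f.support, ∃ d ∈ f.support, d ≠ c ∧ wt d = wt c) :
    ∃ p ∈ R, p.1 ≤ m.degree f := by
  by_contra! hstd
  obtain ⟨d, hd, hne, hdwt⟩ := hfib _ (m.degree_mem_support hf)
  have hwf : WellFounded fun a b : σ →₀ ℕ => a ≺[m] b := InvImage.wf m.toSyn wellFounded_lt
  -- The minimum `e` is taken over all monomials of this weight, not only those of `f`. It is
  -- standard, since exchanging a factor `p.1` for `p.2` keeps the weight and lowers the monomial.
  obtain ⟨e, hewt, hmin⟩ := hwf.has_min {e | wt e = wt d} ⟨d, rfl⟩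
  have hestd : ∀ p ∈ R, ¬ p.1 ≤ e := by
    intro p hp hle
    obtain ⟨r, rfl⟩ := exists_add_of_le hle
    refine hmin (p.2 + r) ?_ ?_
    · rw [Set.mem_ofPred_eq, ← hewt, map_add, map_add, hwt p hp]
    · have := hlt p hp
      rw [map_add, map_add]
      gcongr
  -- By uniqueness the initial exponent is the least of its weight; it is also the largest in `f`,
  -- which leaves no room for `d`.
  have he : e = m.degree f := hinj _ _ hestd hstd (hewt.trans hdwt)
  have h1 : ¬ d ≺[m] m.degree f := he ▸ hmin d rfl
  have h2 := m.le_degree hd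
  exact hne (m.toSyn.injective (le_antisymm h2 (not_lt.1 h1)))

end Binomial

/-! ### The weight of a monomial of `B_G` -/

variable {n : ℕ} {G : SimpleGraph (Fin n ⊕ Fin n)}

/-- The exponents of the images under `ξ` of the variables of `B_G`. -/
noncomputable def varWeight (G : SimpleGraph (Fin n ⊕ Fin n)) :
    (Fin n ⊕ Fin n) ⊕ coverLattice G → (Fin n ⊕ Fin n →₀ ℕ) × ℕ :=
  Sum.elim (fun v => (Finsupp.single v 1, 0)) (fun α => (coverExponent α.1, 1))

/-- The exponent of the image under `ξ` of a monomial of `B_G`. -/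
noncomputable def weight (G : SimpleGraph (Fin n ⊕ Fin n)) :
    ((Fin n ⊕ Fin n) ⊕ coverLattice G →₀ ℕ) →+ (Fin n ⊕ Fin n →₀ ℕ) × ℕ :=
  (Finsupp.linearCombination ℕ (varWeight G)).toAddMonoidHom

theorem weight_single (s : (Fin n ⊕ Fin n) ⊕ coverLattice G) (k : ℕ) :
    weight G (Finsupp.single s k) = k • varWeight G s :=
  Finsupp.linearCombination_single ℕ k s

theorem weight_fst (c : (Fin n ⊕ Fin n) ⊕ coverLattice G →₀ ℕ) (v : Fin n ⊕ Fin n) :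
    (weight G c).1 v = ∑ s ∈ c.support, c s * (varWeight G s).1 v := by
  change (Finsupp.linearCombination ℕ (varWeight G) c).1 v = _
  rw [Finsupp.linearCombination_apply, Finsupp.sum, Prod.fst_sum, Finsupp.finsetSum_apply]
  rfl

theorem weight_snd (c : (Fin n ⊕ Fin n) ⊕ coverLattice G →₀ ℕ) :
    (weight G c).2 = ∑ s ∈ c.support, c s * (varWeight G s).2 := by
  change (Finsupp.linearCombination ℕ (varWeight G) c).2 = _
  rw [Finsupp.linearCombination_apply, Finsupp.sum, Prod.snd_sum]
  rfl

/-- Every variable goes to a monomial and `ξ` is multiplicative. This turns membership in `Q_G` into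
a statement about weights. -/
theorem toricMap_monomial (K : Type*) [Field K] (hG : IsUnmixedBipartite G)
    (c : (Fin n ⊕ Fin n) ⊕ coverLattice G →₀ ℕ) (r : K) :
    (toricMap K hG (MvPolynomial.monomial c r) : Polynomial (MvPolynomial (Fin n ⊕ Fin n) K)) =
      Polynomial.monomial (weight G c).2 (MvPolynomial.monomial (weight G c).1 r) := by
  have hX : ∀ s, (toricMap K hG (MvPolynomial.X s) :
      Polynomial (MvPolynomial (Fin n ⊕ Fin n) K)) =
        Polynomial.monomial (varWeight G s).2 (MvPolynomial.monomial (varWeight G s).1 1) := by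
    rintro (v | α)
    · simp only [toricMap, MvPolynomial.aeval_X]
      rfl
    · simp only [toricMap, MvPolynomial.aeval_X]
      rfl
  have h1 : (toricMap K hG (MvPolynomial.monomial c 1) :
      Polynomial (MvPolynomial (Fin n ⊕ Fin n) K)) =
        Polynomial.monomial (weight G c).2 (MvPolynomial.monomial (weight G c).1 1) := by
    induction c using Finsupp.induction_linear with
    | zero =>
      rw [map_zero, Prod.fst_zero, Prod.snd_zero, MvPolynomial.monomial_zero', map_one, map_one]
      rfl
    | add c d hc hd =>
      rw [← mul_one (1 : K), ← MvPolynomial.monomial_mul, map_mul, MulMemClass.coe_mul, hc, hd,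
        Polynomial.monomial_mul_monomial, MvPolynomial.monomial_mul, map_add, Prod.fst_add,
        Prod.snd_add]
    | single s k =>
      rw [← MvPolynomial.X_pow_eq_monomial, map_pow, SubmonoidClass.coe_pow, hX,
        Polynomial.monomial_pow, MvPolynomial.monomial_pow, one_pow, weight_single, Prod.smul_fst,
        Prod.smul_snd, smul_eq_mul, mul_comm]
  have hr : MvPolynomial.monomial c r = r • MvPolynomial.monomial c (1 : K) := by
    rw [MvPolynomial.smul_monomial, smul_eq_mul, mul_one]
  rw [hr, map_smul, SetLike.val_smul, h1, Polynomial.smul_monomial, MvPolynomial.smul_monomial,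
    smul_eq_mul, mul_one]

theorem binomial_mem_toricIdeal (K : Type*) [Field K] (hG : IsUnmixedBipartite G)
    {a b : (Fin n ⊕ Fin n) ⊕ coverLattice G →₀ ℕ} (h : weight G a = weight G b) :
    MvPolynomial.monomial a (1 : K) - MvPolynomial.monomial b 1 ∈ toricIdeal K hG := by
  rw [toricIdeal, RingHom.mem_ker, map_sub, sub_eq_zero]
  apply Subtype.ext
  rw [toricMap_monomial, toricMap_monomial, h]

/-- Every monomial of an element of `Q_G` has the same image as another one. -/
theorem exists_same_weight {K : Type*} [Field K] {hG : IsUnmixedBipartite G}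
    {f : MvPolynomial ((Fin n ⊕ Fin n) ⊕ coverLattice G) K} (hf : f ∈ toricIdeal K hG)
    {c : (Fin n ⊕ Fin n) ⊕ coverLattice G →₀ ℕ} (hc : c ∈ f.support) :
    ∃ d ∈ f.support, d ≠ c ∧ weight G d = weight G c := by
  classical
  by_contra! hd
  have h0 : (toricMap K hG f : Polynomial (MvPolynomial (Fin n ⊕ Fin n) K)) = 0 := by
    rw [toricIdeal, RingHom.mem_ker] at hf
    rw [hf]; rfl
  have h1 : (toricMap K hG f : Polynomial (MvPolynomial (Fin n ⊕ Fin n) K)) =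
      ∑ d ∈ f.support, Polynomial.monomial (weight G d).2
        (MvPolynomial.monomial (weight G d).1 (f.coeff d)) := by
    conv_lhs => rw [f.as_sum]
    rw [map_sum, AddSubmonoidClass.coe_finsetSum]
    exact Finset.sum_congr rfl fun d _ => toricMap_monomial K hG d _
  -- Compare coefficients at the image of `c`: only monomials of the same weight contribute, so if
  -- `c` were alone its own nonzero coefficient would remain.
  have h2 := congrArg (fun p =>
      MvPolynomial.coeff (weight G c).1 (Polynomial.coeff p (weight G c).2))
    (h1.symm.trans h0)
  simp only [Polynomial.finsetSum_coeff, MvPolynomial.coeff_sum, Polynomial.coeff_zero,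
    MvPolynomial.coeff_zero] at h2
  rw [Finset.sum_eq_single c] at h2
  · rw [Polynomial.coeff_monomial, if_pos rfl, MvPolynomial.coeff_monomial, if_pos rfl] at h2
    exact MvPolynomial.mem_support_iff.1 hc h2
  · intro d hdf hdc
    have hne := hd d hdf hdc
    rw [Polynomial.coeff_monomial]
    split_ifs with h3
    · rw [MvPolynomial.coeff_monomial, if_neg]
      exact fun h4 => hne (Prod.ext h4 h3)
    · simp
  · exact fun h => absurd hc h

/-! ### Standard monomials -/

/-- The monomials of `B_G` divisible by none of the initial monomials of the Gröbner basis: the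
`u`-variables form a chain, and no `x_{β∖α} u_α` with `α ⊂ β` divides the monomial. -/
structure IsStandard (c : (Fin n ⊕ Fin n) ⊕ coverLattice G →₀ ℕ) : Prop where
  exists_eq_zero : ∀ α β : coverLattice G, α < β → c (Sum.inr α) ≠ 0 →
    ∃ i ∈ β.1 \ α.1, c (Sum.inl (Sum.inl i)) = 0
  chain : ∀ α β : coverLattice G, c (Sum.inr α) ≠ 0 → c (Sum.inr β) ≠ 0 → α ≤ β ∨ β ≤ α

/-- Standardness passes to divisors, which lets the induction cancel a `u`-variable. -/
theorem IsStandard.of_le {c d : (Fin n ⊕ Fin n) ⊕ coverLattice G →₀ ℕ} (hd : IsStandard d)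
    (h : c ≤ d) : IsStandard c where
  exists_eq_zero α β hαβ hα := by
    obtain ⟨i, hi, h0⟩ := hd.exists_eq_zero α β hαβ (by have := h (Sum.inr α); omega)
    exact ⟨i, hi, by have := h (Sum.inl (Sum.inl i)); omega⟩
  chain α β hα hβ := hd.chain α β (by have := h (Sum.inr α); omega)
    (by have := h (Sum.inr β); omega)

/-- The degree in `t` counts the `u`-variables with multiplicity. -/
theorem weight_snd_eq_zero_iff (c : (Fin n ⊕ Fin n) ⊕ coverLattice G →₀ ℕ) :
    (weight G c).2 = 0 ↔ ∀ α, c (Sum.inr α) = 0 := by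
  rw [weight_snd, Finset.sum_eq_zero_iff]
  constructor
  · intro h α
    by_contra h0
    exact h0 (by simpa [varWeight] using h _ (Finsupp.mem_support_iff.2 h0))
  · rintro h (v | α) _
    · simp [varWeight]
    · simp [h α]

theorem weight_fst_of_snd_eq_zero {c : (Fin n ⊕ Fin n) ⊕ coverLattice G →₀ ℕ}
    (h : (weight G c).2 = 0) (v : Fin n ⊕ Fin n) : (weight G c).1 v = c (Sum.inl v) := by
  rw [weight_fst, Finset.sum_eq_single (Sum.inl v)]
  · simp [varWeight]
  · rintro (w | α) _ hne
    · have : w ≠ v := fun e => hne (e ▸ rfl)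
      simp [varWeight, this]
    · rw [(weight_snd_eq_zero_iff c).1 h α, zero_mul]
  · intro h0
    rw [Finsupp.notMem_support_iff.1 h0, zero_mul]

/-- An `x_i` in the image comes either from `x_i` itself or from some `u_α` with `i ∈ α`. This lemma
and the next are all that is needed to locate the greatest `u`-variable. -/
theorem weight_inl_ne_zero {c : (Fin n ⊕ Fin n) ⊕ coverLattice G →₀ ℕ} {α : coverLattice G}
    (hα : c (Sum.inr α) ≠ 0) {i : Fin n} (hi : i ∈ α.1) : (weight G c).1 (Sum.inl i) ≠ 0 := by
  rw [weight_fst, Ne, Finset.sum_eq_zero_iff]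
  intro h
  have h0 := h (Sum.inr α) (Finsupp.mem_support_iff.2 hα)
  exact hα (by simpa [varWeight, coverExponent_inl, hi] using h0)

theorem exists_of_weight_inl_ne_zero {c : (Fin n ⊕ Fin n) ⊕ coverLattice G →₀ ℕ} {i : Fin n}
    (h : (weight G c).1 (Sum.inl i) ≠ 0) :
    c (Sum.inl (Sum.inl i)) ≠ 0 ∨ ∃ α : coverLattice G, c (Sum.inr α) ≠ 0 ∧ i ∈ α.1 := by
  classical
  rw [weight_fst] at h
  obtain ⟨s, -, hs⟩ := Finset.exists_ne_zero_of_sum_ne_zero h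
  rcases s with v | α
  · left
    obtain ⟨hv, hw⟩ := mul_ne_zero_iff.1 hs
    have : v = Sum.inl i := by
      by_contra hne
      simp [varWeight, hne] at hw
    rwa [this] at hv
  · right
    obtain ⟨hv, hw⟩ := mul_ne_zero_iff.1 hs
    refine ⟨α, hv, ?_⟩
    by_contra hne
    simp [varWeight, coverExponent_inl, hne] at hw

/-- The `u`-variables of a standard monomial have a greatest element. -/
theorem IsStandard.exists_greatest {c : (Fin n ⊕ Fin n) ⊕ coverLattice G →₀ ℕ}
    (hc : IsStandard c) (h : (weight G c).2 ≠ 0) :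
    ∃ μ : coverLattice G, c (Sum.inr μ) ≠ 0 ∧ ∀ α, c (Sum.inr α) ≠ 0 → α ≤ μ := by
  rw [Ne, weight_snd_eq_zero_iff] at h
  push Not at h
  obtain ⟨μ, hμ⟩ := (Set.toFinite {α : coverLattice G | c (Sum.inr α) ≠ 0}).exists_maximal h
  refine ⟨μ, hμ.prop, fun α hα => ?_⟩
  rcases hc.chain α μ hα hμ.prop with h1 | h1
  · exact h1
  · exact hμ.le_of_ge hα h1

/-- The greatest `u`-variable of a standard monomial bounds the `u`-variables of every monomial
of the same weight. -/
theorem IsStandard.le_greatest (hG : IsUnmixedBipartite G)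
    {c d : (Fin n ⊕ Fin n) ⊕ coverLattice G →₀ ℕ} (hc : IsStandard c)
    (h : weight G c = weight G d) {μ ν : coverLattice G} (hμ : c (Sum.inr μ) ≠ 0)
    (hmax : ∀ α, c (Sum.inr α) ≠ 0 → α ≤ μ) (hν : d (Sum.inr ν) ≠ 0) : ν ≤ μ := by
  by_contra hle
  -- Closure under union enters here: standardness at `μ ⊂ μ ∪ ν` yields `i ∈ ν \ μ` with `x_i`
  -- absent from `c`. Yet `u_ν` puts `x_i` into the common image, and the `u`-variables of `c` lie
  -- below `μ`, so they cannot account for it.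
  have hlt : μ < unionL hG μ ν := by
    refine lt_of_le_not_ge (Finset.subset_union_left (s₁ := μ.1)) fun h' => hle ?_
    exact (Finset.subset_union_right (s₁ := μ.1)).trans h'
  obtain ⟨i, hi, h0⟩ := hc.exists_eq_zero μ _ hlt hμ
  rw [Finset.mem_sdiff] at hi
  have hiν : i ∈ ν.1 := (Finset.mem_union.1 hi.1).resolve_left hi.2
  have hw := weight_inl_ne_zero hν hiν
  rw [← h] at hw
  rcases exists_of_weight_inl_ne_zero hw with h1 | ⟨α, hα, hiα⟩
  · exact h1 h0
  · exact hi.2 (hmax α hα hiα)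

/-- Standard monomials are determined by their images under `ξ`. -/
theorem IsStandard.eq_of_weight_eq (hG : IsUnmixedBipartite G)
    {c d : (Fin n ⊕ Fin n) ⊕ coverLattice G →₀ ℕ} (hc : IsStandard c) (hd : IsStandard d)
    (h : weight G c = weight G d) : c = d := by
  induction hk : (weight G c).2 generalizing c d with
  | zero =>
    have hk' : (weight G d).2 = 0 := h ▸ hk
    ext (v | α)
    · rw [← weight_fst_of_snd_eq_zero hk, ← weight_fst_of_snd_eq_zero hk', h]
    · rw [(weight_snd_eq_zero_iff c).1 hk, (weight_snd_eq_zero_iff d).1 hk']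
  | succ k ih =>
    have hk' : (weight G d).2 = k + 1 := h ▸ hk
    obtain ⟨μ, hμ, hmaxμ⟩ := hc.exists_greatest (by omega)
    obtain ⟨ν, hν, hmaxν⟩ := hd.exists_greatest (by omega)
    obtain rfl : ν = μ := le_antisymm (hc.le_greatest hG h hμ hmaxμ hν)
      (hd.le_greatest hG h.symm hν hmaxν hμ)
    -- Both monomials contain the same greatest `u`-variable; cancelling one copy lowers the degree
    -- in `t` by one.
    obtain ⟨c', rfl⟩ := exists_add_of_le
      (Finsupp.single_le_iff.2 (Nat.one_le_iff_ne_zero.2 hμ))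
    obtain ⟨d', rfl⟩ := exists_add_of_le
      (Finsupp.single_le_iff.2 (Nat.one_le_iff_ne_zero.2 hν))
    rw [map_add, map_add, add_right_inj] at h
    have hk2 : (weight G c').2 = k := by
      rw [map_add, weight_single, Prod.snd_add, one_smul] at hk
      simp only [varWeight, Sum.elim_inr] at hk
      omega
    rw [ih (hc.of_le le_add_self) (hd.of_le le_add_self) h hk2]

/-! ### The exponents of the monomials in the Gröbner basis -/

/-- The exponent of `x_{β∖α} * u_α`. -/
noncomputable def expXU (α β : coverLattice G) : (Fin n ⊕ Fin n) ⊕ coverLattice G →₀ ℕ :=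
  ∑ i ∈ β.1 \ α.1, Finsupp.single (Sum.inl (Sum.inl i)) 1 + Finsupp.single (Sum.inr α) 1

/-- The exponent of `y_{β∖α} * u_β`. -/
noncomputable def expYU (α β : coverLattice G) : (Fin n ⊕ Fin n) ⊕ coverLattice G →₀ ℕ :=
  ∑ i ∈ β.1 \ α.1, Finsupp.single (Sum.inl (Sum.inr i)) 1 + Finsupp.single (Sum.inr β) 1

/-- The exponent of `u_α * u_β`. -/
noncomputable def expUU (α β : coverLattice G) : (Fin n ⊕ Fin n) ⊕ coverLattice G →₀ ℕ :=
  Finsupp.single (Sum.inr α) 1 + Finsupp.single (Sum.inr β) 1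

theorem xu_eq (K : Type*) [Field K] (α β : coverLattice G) :
    xu K α β = MvPolynomial.monomial (expXU α β) 1 := by
  simp only [xu, varX, varU, expXU, MvPolynomial.X, ← MvPolynomial.monomial_sum_one,
    MvPolynomial.monomial_mul, mul_one]

theorem yu_eq (K : Type*) [Field K] (α β : coverLattice G) :
    yu K α β = MvPolynomial.monomial (expYU α β) 1 := by
  simp only [yu, varY, varU, expYU, MvPolynomial.X, ← MvPolynomial.monomial_sum_one,
    MvPolynomial.monomial_mul, mul_one]

theorem varU_mul_varU (K : Type*) [Field K] (α β : coverLattice G) :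
    varU K α * varU K β = MvPolynomial.monomial (expUU α β) 1 := by
  simp only [varU, expUU, MvPolynomial.X, MvPolynomial.monomial_mul, mul_one]

section Apply

variable (α β γ : coverLattice G) (i : Fin n)

theorem expXU_x : expXU α β (Sum.inl (Sum.inl i)) = if i ∈ β.1 \ α.1 then 1 else 0 := by
  classical
  simp [expXU, Finsupp.single_apply]

theorem expXU_y : expXU α β (Sum.inl (Sum.inr i)) = 0 := by
  simp [expXU]

theorem expXU_u [DecidableEq (coverLattice G)] :
    expXU α β (Sum.inr γ) = if α = γ then 1 else 0 := by
  simp [expXU, Finsupp.single_apply]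

theorem expYU_x : expYU α β (Sum.inl (Sum.inl i)) = 0 := by
  simp [expYU]

theorem expYU_u [DecidableEq (coverLattice G)] :
    expYU α β (Sum.inr γ) = if β = γ then 1 else 0 := by
  simp [expYU, Finsupp.single_apply]

theorem expUU_inl (v : Fin n ⊕ Fin n) : expUU α β (Sum.inl v) = 0 := by
  simp [expUU]

theorem expUU_u [DecidableEq (coverLattice G)] : expUU α β (Sum.inr γ) =
    (if α = γ then 1 else 0) + (if β = γ then 1 else 0) := by
  simp [expUU, Finsupp.single_apply]

end Apply

/-- `x_{β∖α} * u_α` divides a monomial iff all its variables do. -/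
theorem expXU_le_iff {α β : coverLattice G} {c : (Fin n ⊕ Fin n) ⊕ coverLattice G →₀ ℕ} :
    expXU α β ≤ c ↔ (∀ i ∈ β.1 \ α.1, c (Sum.inl (Sum.inl i)) ≠ 0) ∧ c (Sum.inr α) ≠ 0 := by
  classical
  constructor
  · refine fun h => ⟨fun i hi => ?_, ?_⟩
    · have := h (Sum.inl (Sum.inl i))
      rw [expXU_x, if_pos hi] at this
      omega
    · have := h (Sum.inr α)
      rw [expXU_u, if_pos rfl] at this
      omega
  · rintro ⟨h1, h2⟩ ((i | i) | γ)
    · rw [expXU_x]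
      split_ifs with hi
      · exact Nat.one_le_iff_ne_zero.2 (h1 i hi)
      · exact Nat.zero_le _
    · rw [expXU_y]; exact Nat.zero_le _
    · rw [expXU_u]
      split_ifs with hi
      · exact hi ▸ Nat.one_le_iff_ne_zero.2 h2
      · exact Nat.zero_le _

/-- The two indices must differ, since divisibility by a square `u_α ^ 2` would require exponent at
least two. -/
theorem expUU_le_iff {α β : coverLattice G} (hne : α ≠ β)
    {c : (Fin n ⊕ Fin n) ⊕ coverLattice G →₀ ℕ} :
    expUU α β ≤ c ↔ c (Sum.inr α) ≠ 0 ∧ c (Sum.inr β) ≠ 0 := by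
  classical
  constructor
  · refine fun h => ⟨?_, ?_⟩
    · have := h (Sum.inr α)
      rw [expUU_u, if_pos rfl] at this
      omega
    · have := h (Sum.inr β)
      rw [expUU_u, if_pos rfl] at this
      omega
  · rintro ⟨h1, h2⟩ (v | γ)
    · rw [expUU_inl]; exact Nat.zero_le _
    · rw [expUU_u]
      by_cases hα : α = γ
      · subst hα
        rw [if_pos rfl, if_neg hne.symm]
        omega
      · rw [if_neg hα]
        split_ifs with hβ
        · subst hβ; omega
        · omega

/-- Both sides have image `x_β y_{αᶜ} t`: the factor `x_{β∖α}` completes the `x`-part of `m_α`, and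
`y_{β∖α}` completes the `y`-part of `m_β`. -/
theorem weight_expXU {α β : coverLattice G} (h : α ≤ β) :
    weight G (expXU α β) = weight G (expYU α β) := by
  classical
  simp only [expXU, expYU, map_add, map_sum, weight_single, one_smul, varWeight, Sum.elim_inl,
    Sum.elim_inr]
  refine Prod.ext (Finsupp.ext fun v => ?_) (by simp [Prod.snd_sum])
  have hle : α.1 ⊆ β.1 := h
  rcases v with i | i
  · have := @hle i
    simp only [Prod.fst_add, Prod.fst_sum, Finsupp.add_apply, Finsupp.finsetSum_apply,
      Finsupp.single_apply, coverExponent_inl, Sum.inl.injEq, reduceCtorEq, if_false,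
      Finset.sum_ite_eq', Finset.sum_const_zero, Finset.mem_sdiff]
    by_cases hα : i ∈ α.1 <;> by_cases hβ : i ∈ β.1 <;> simp_all
  · have := @hle i
    simp only [Prod.fst_add, Prod.fst_sum, Finsupp.add_apply, Finsupp.finsetSum_apply,
      Finsupp.single_apply, coverExponent_inr, Sum.inr.injEq, reduceCtorEq, if_false,
      Finset.sum_ite_eq', Finset.sum_const_zero, Finset.mem_sdiff]
    by_cases hα : i ∈ α.1 <;> by_cases hβ : i ∈ β.1 <;> simp_all

/-- Each index lies in as many of `α`, `β` as of `α ∪ β`, `α ∩ β`. -/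
theorem weight_expUU (hG : IsUnmixedBipartite G) (α β : coverLattice G) :
    weight G (expUU α β) = weight G (expUU (unionL hG α β) (interL hG α β)) := by
  simp only [expUU, map_add, weight_single, one_smul, varWeight, Sum.elim_inr]
  refine Prod.ext (Finsupp.ext fun v => ?_) rfl
  rcases v with i | i
  · simp only [Prod.fst_add, Finsupp.add_apply, coverExponent_inl, unionL, interL,
      Finset.mem_union, Finset.mem_inter]
    by_cases hα : i ∈ α.1 <;> by_cases hβ : i ∈ β.1 <;> simp_all
  · simp only [Prod.fst_add, Finsupp.add_apply, coverExponent_inr, unionL, interL,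
      Finset.mem_union, Finset.mem_inter]
    by_cases hα : i ∈ α.1 <;> by_cases hβ : i ∈ β.1 <;> simp_all

/-! ### Initial monomials -/

/-- The `x_i` are compared first and occur only in `x_{β∖α} u_α`, so the comparison is decided at
the least index of `β \ α` and never reaches the `u`-variables. -/
theorem expYU_lt_expXU (o : LinearOrder (coverLattice G)) {α β : coverLattice G} (h : α < β) :
    expYU α β ≺[lexSharp G o] expXU α β := by
  have hne : (β.1 \ α.1).Nonempty := Finset.sdiff_nonempty.2 fun h' => h.not_ge h'
  refine (prodOrder_lt_iff _ _ _ _).2 (Or.inl ((lexXY_lt_iff _ _).2 (Or.inl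
    ⟨(β.1 \ α.1).min' hne, fun j hj => ?_, ?_⟩)))
  · rw [Finsupp.fst_sumFinsuppAddEquivProdFinsupp, Finsupp.fst_sumFinsuppAddEquivProdFinsupp,
      expYU_x, expXU_x, if_neg]
    exact fun hmem => (Finset.min'_le _ _ hmem).not_gt hj
  · rw [Finsupp.fst_sumFinsuppAddEquivProdFinsupp, Finsupp.fst_sumFinsuppAddEquivProdFinsupp,
      expYU_x, expXU_x, if_pos (Finset.min'_mem _ hne)]
    exact Nat.one_pos

/-- Both monomials have degree two and no `x_i` or `y_i`. By `ho`, `u_{α∩β}` is the smallest of the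
four variables; it occurs only in the product with the union, which reverse lexicographic order
therefore makes smaller. -/
theorem expUU_lt_expUU (hG : IsUnmixedBipartite G) (o : LinearOrder (coverLattice G))
    (ho : ∀ α β : coverLattice G, β.1 ⊂ α.1 → o.lt β α) {α β : coverLattice G}
    (h1 : ¬ α.1 ⊆ β.1) (h2 : ¬ β.1 ⊆ α.1) :
    expUU (unionL hG α β) (interL hG α β) ≺[lexSharp G o] expUU α β := by
  classical
  have hsnd : ∀ γ δ : coverLattice G, (Finsupp.sumFinsuppAddEquivProdFinsupp (expUU γ δ)).2 =
      Finsupp.single γ 1 + Finsupp.single δ 1 := by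
    intro γ δ
    ext ε
    rw [Finsupp.snd_sumFinsuppAddEquivProdFinsupp, expUU_u, Finsupp.add_apply,
      Finsupp.single_apply, Finsupp.single_apply]
  have hα : (interL hG α β).1 ⊂ α.1 :=
    Finset.ssubset_iff_subset_ne.2 ⟨Finset.inter_subset_left, fun e =>
      h1 (Finset.inter_eq_left.1 e)⟩
  have hβ : (interL hG α β).1 ⊂ β.1 :=
    Finset.ssubset_iff_subset_ne.2 ⟨Finset.inter_subset_right, fun e =>
      h2 (Finset.inter_eq_right.1 e)⟩
  have hU : (interL hG α β).1 ⊂ (unionL hG α β).1 := hα.trans_subset Finset.subset_union_left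
  refine (prodOrder_lt_iff _ _ _ _).2 (Or.inr ⟨?_, ?_⟩)
  · ext v
    rw [Finsupp.fst_sumFinsuppAddEquivProdFinsupp, Finsupp.fst_sumFinsuppAddEquivProdFinsupp,
      expUU_inl, expUU_inl]
  · rw [hsnd, hsnd]
    refine (@revLex_lt_iff _ _ o _ _).2 (Or.inr ⟨by simp, interL hG α β, fun j hj => ?_, ?_⟩)
    · have hlt : ∀ γ : coverLattice G, (interL hG α β).1 ⊂ γ.1 → γ ≠ j := by
        rintro γ hγ rfl
        exact @lt_asymm _ o.toPreorder _ _ hj (ho _ _ hγ)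
      have hne : interL hG α β ≠ j := by
        rintro rfl
        exact @lt_irrefl _ o.toPreorder _ hj
      simp [hlt α hα, hlt β hβ, hlt _ hU, hne]
    · have hlt : ∀ γ : coverLattice G, (interL hG α β).1 ⊂ γ.1 → γ ≠ interL hG α β := by
        rintro γ hγ rfl
        exact hγ.ne rfl
      simp [Finsupp.single_apply, hlt α hα, hlt β hβ]

/-! ### Assembling the reduced Gröbner basis -/

/-- The pairs of exponents of the binomials in the Gröbner basis. -/
def moves (hG : IsUnmixedBipartite G) :
    Set (((Fin n ⊕ Fin n) ⊕ coverLattice G →₀ ℕ) × ((Fin n ⊕ Fin n) ⊕ coverLattice G →₀ ℕ)) :=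
  {p | ∃ α β : coverLattice G, α ⋖ β ∧ p = (expXU α β, expYU α β)} ∪
    {p | ∃ α β : coverLattice G, ¬ α.1 ⊆ β.1 ∧ ¬ β.1 ⊆ α.1 ∧
      p = (expUU α β, expUU (unionL hG α β) (interL hG α β))}

theorem finite_moves (hG : IsUnmixedBipartite G) : (moves hG).Finite := by
  refine Set.Finite.union
    ((Set.finite_range fun q : coverLattice G × coverLattice G =>
      (expXU q.1 q.2, expYU q.1 q.2)).subset ?_)
    ((Set.finite_range fun q : coverLattice G × coverLattice G =>
      (expUU q.1 q.2, expUU (unionL hG q.1 q.2) (interL hG q.1 q.2))).subset ?_)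
  · rintro _ ⟨α, β, -, rfl⟩
    exact ⟨(α, β), rfl⟩
  · rintro _ ⟨α, β, -, -, rfl⟩
    exact ⟨(α, β), rfl⟩

theorem lt_of_mem_moves {hG : IsUnmixedBipartite G} (o : LinearOrder (coverLattice G))
    (ho : ∀ α β : coverLattice G, β.1 ⊂ α.1 → o.lt β α) :
    ∀ p ∈ moves hG, p.2 ≺[lexSharp G o] p.1 := by
  rintro _ (⟨α, β, h, rfl⟩ | ⟨α, β, h1, h2, rfl⟩)
  · exact expYU_lt_expXU o h.lt
  · exact expUU_lt_expUU hG o ho h1 h2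

theorem weight_eq_of_mem_moves {hG : IsUnmixedBipartite G} :
    ∀ p ∈ moves hG, weight G p.1 = weight G p.2 := by
  rintro _ (⟨α, β, h, rfl⟩ | ⟨α, β, h1, h2, rfl⟩)
  · exact weight_expXU h.le
  · exact weight_expUU hG α β

theorem isStandard_of_forall_moves {hG : IsUnmixedBipartite G}
    {c : (Fin n ⊕ Fin n) ⊕ coverLattice G →₀ ℕ} (h : ∀ p ∈ moves hG, ¬ p.1 ≤ c) :
    IsStandard c where
  exists_eq_zero α β hαβ hα := by
    -- Upper neighbours suffice: for `α ⋖ γ ≤ β` the monomial `x_{γ∖α} u_α` divides `x_{β∖α} u_α`.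
    obtain ⟨γ, hγ, hγβ⟩ := exists_covBy_le_of_lt hαβ
    have h1 := h _ (Or.inl ⟨α, γ, hγ, rfl⟩)
    rw [expXU_le_iff] at h1
    by_contra! h2
    exact h1 ⟨fun i hi => h2 i (Finset.sdiff_subset_sdiff hγβ le_rfl hi), hα⟩
  chain α β hα hβ := by
    by_contra! h1
    have hne : α ≠ β := fun e => h1.1 e.le
    exact h _ (Or.inr ⟨α, β, h1.1, h1.2, rfl⟩) ((expUU_le_iff hne).2 ⟨hα, hβ⟩)

/-- The initial exponent of a move divides no exponent of another move. -/
theorem eq_of_mem_moves_of_le {hG : IsUnmixedBipartite G} {p q} (hp : p ∈ moves hG)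
    (hq : q ∈ moves hG) (h : q.1 ≤ p.1 ∨ q.1 ≤ p.2) : q = p := by
  classical
  have hsd : ∀ {γ δ : coverLattice G}, γ ⋖ δ → ∃ i, i ∈ δ.1 \ γ.1 := fun h =>
    Finset.sdiff_nonempty.2 fun h' => h.lt.not_ge h'
  have hu : ∀ {α β γ : coverLattice G}, expUU α β (Sum.inr γ) ≠ 0 → γ = α ∨ γ = β := by
    intro α β γ hγ
    by_contra! hne
    rw [expUU_u, if_neg hne.1.symm, if_neg hne.2.symm] at hγ
    exact hγ rfl
  rcases hq with ⟨γ, δ, hγδ, rfl⟩ | ⟨γ, δ, h1, h2, rfl⟩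
  -- The divisor contains some `x_i`, so it can only divide a monomial `x_{β∖α} u_α`.
  · obtain ⟨i, hi⟩ := hsd hγδ
    rcases hp with ⟨α, β, hαβ, rfl⟩ | ⟨α, β, h3, h4, rfl⟩
    · rcases h with h | h
      · rw [expXU_le_iff, expXU_u] at h
        obtain rfl : α = γ := by
          by_contra hne
          exact h.2 (if_neg hne)
        have hle : δ ≤ β := by
          intro j hj
          by_cases hjα : j ∈ α.1
          · exact hαβ.le hjα
          · have := h.1 j (Finset.mem_sdiff.2 ⟨hj, hjα⟩)
            rw [expXU_x] at this
            by_contra hjβ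
            exact this (if_neg fun h' => hjβ (Finset.mem_sdiff.1 h').1)
        -- Divisibility gives `α < δ ≤ β`, and nothing lies strictly between `α` and its upper
        -- neighbour `β`.
        obtain rfl : δ = β := hle.eq_of_not_lt fun hlt => hαβ.2 hγδ.lt hlt
        rfl
      · exact absurd (expYU_x _ _ _) ((expXU_le_iff.1 h).1 i hi)
    · rcases h with h | h
      · exact absurd (expUU_inl _ _ _) ((expXU_le_iff.1 h).1 i hi)
      · exact absurd (expUU_inl _ _ _) ((expXU_le_iff.1 h).1 i hi)
  -- The divisor has two distinct, incomparable `u`-variables. A monomial with a single `u`-variable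
  -- is excluded, and so is the product of union and intersection, whose indices are comparable.
  · have hne : γ ≠ δ := by
      rintro rfl
      exact h1 le_rfl
    simp only [expUU_le_iff hne] at h
    rcases hp with ⟨α, β, hαβ, rfl⟩ | ⟨α, β, h3, h4, rfl⟩
    · exfalso
      rcases h with ⟨hγ, hδ⟩ | ⟨hγ, hδ⟩
      · rw [expXU_u, ite_ne_right_iff] at hγ hδ
        exact hne (hγ.1.symm.trans hδ.1)
      · rw [expYU_u, ite_ne_right_iff] at hγ hδ
        exact hne (hγ.1.symm.trans hδ.1)
    · have hle : (interL hG α β).1 ⊆ (unionL hG α β).1 :=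
        Finset.inter_subset_left.trans Finset.subset_union_left
      rcases h with ⟨hγ, hδ⟩ | ⟨hγ, hδ⟩
      · rcases hu hγ with rfl | rfl <;> rcases hu hδ with rfl | rfl
        · exact absurd rfl hne
        · rfl
        -- Exchanging the two indices gives the same move, so the generator is listed twice but is a
        -- single element.
        · have hU : unionL hG γ δ = unionL hG δ γ := Subtype.ext (Finset.union_comm _ _)
          have hI : interL hG γ δ = interL hG δ γ := Subtype.ext (Finset.inter_comm _ _)
          have hswap : expUU γ δ = expUU δ γ := add_comm _ _
          rw [hU, hI, hswap]
        · exact absurd rfl hne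
      · exfalso
        rcases hu hγ with rfl | rfl <;> rcases hu hδ with rfl | rfl
        · exact hne rfl
        · exact h2 hle
        · exact h1 hle
        · exact hne rfl

theorem isReducedGroebnerBasis_moves (K : Type*) [Field K] (hG : IsUnmixedBipartite G)
    (o : LinearOrder (coverLattice G))
    (ho : ∀ α β : coverLattice G, β.1 ⊂ α.1 → o.lt β α) :
    IsReducedGroebnerBasis (lexSharp G o) (toricIdeal K hG)
      ((fun p => MvPolynomial.monomial p.1 (1 : K) - MvPolynomial.monomial p.2 1) ''
        moves hG) := by
  have hlt := lt_of_mem_moves (hG := hG) o ho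
  have hsub : (fun p => MvPolynomial.monomial p.1 (1 : K) - MvPolynomial.monomial p.2 1) ''
      moves hG ⊆ (toricIdeal K hG : Set _) := by
    rintro _ ⟨p, hp, rfl⟩
    exact binomial_mem_toricIdeal K hG (weight_eq_of_mem_moves p hp)
  have hmonic : ∀ g ∈ (fun p => MvPolynomial.monomial p.1 (1 : K) -
      MvPolynomial.monomial p.2 1) '' moves hG, (lexSharp G o).Monic g := by
    rintro _ ⟨p, hp, rfl⟩
    exact monic_binomial _ (hlt p hp)
  refine ⟨(finite_moves hG).image _, hsub, span_leadingTerm_eq _ hsub hmonic ?_, hmonic, ?_⟩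
  · intro f hf h0
    obtain ⟨p, hp, hle⟩ := exists_move_le_degree (lexSharp G o) (weight G) hlt
      weight_eq_of_mem_moves (fun c d hc hd h => (isStandard_of_forall_moves hc).eq_of_weight_eq
        hG (isStandard_of_forall_moves hd) h) h0 fun c hc => exists_same_weight hf hc
    refine ⟨_, ⟨p, hp, rfl⟩, ?_⟩
    dsimp only
    rwa [degree_binomial _ (hlt p hp)]
  · rintro _ ⟨p, hp, rfl⟩ _ ⟨q, hq, rfl⟩ hne c hc hle
    dsimp only at hle
    rw [degree_binomial _ (hlt q hq)] at hle
    suffices hqp : q = p from hne (hqp ▸ rfl)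
    refine eq_of_mem_moves_of_le hp hq ?_
    rcases mem_support_binomial hc with rfl | rfl
    · exact Or.inl hle
    · exact Or.inr hle

/-- The condition that `α` is not the whole set costs nothing: the whole set has no upper neighbour.
-/
theorem image_moves (K : Type*) [Field K] (hG : IsUnmixedBipartite G) :
    (fun p => MvPolynomial.monomial p.1 (1 : K) - MvPolynomial.monomial p.2 1) '' moves hG =
      {g | ∃ α β : coverLattice G, α.1 ≠ Finset.univ ∧ β ∈ upperNeighbours α ∧
          g = xu K α β - yu K α β} ∪
        {g | ∃ α β : coverLattice G, ¬ α.1 ⊆ β.1 ∧ ¬ β.1 ⊆ α.1 ∧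
          g = varU K α * varU K β - varU K (unionL hG α β) * varU K (interL hG α β)} := by
  simp only [xu_eq, yu_eq, varU_mul_varU]
  ext g
  constructor
  · rintro ⟨_, ⟨α, β, h, rfl⟩ | ⟨α, β, h1, h2, rfl⟩, rfl⟩
    · refine Or.inl ⟨α, β, fun hα => h.lt.not_ge ?_, h, rfl⟩
      change β.1 ⊆ α.1
      rw [hα]
      exact Finset.subset_univ _
    · exact Or.inr ⟨α, β, h1, h2, rfl⟩
  · rintro (⟨α, β, -, h, rfl⟩ | ⟨α, β, h1, h2, rfl⟩)
    · exact ⟨_, Or.inl ⟨α, β, h, rfl⟩, rfl⟩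
    · exact ⟨_, Or.inr ⟨α, β, h1, h2, rfl⟩, rfl⟩

end VertexCoverAlgebra

theorem theorem2p1 {K : Type*} [Field K] {n : ℕ} (hn : 1 ≤ n)
    (G : SimpleGraph (Fin n ⊕ Fin n)) (hG : VertexCoverAlgebra.IsUnmixedBipartite G)
    (o : LinearOrder (VertexCoverAlgebra.coverLattice G))
    (ho : ∀ α β : VertexCoverAlgebra.coverLattice G, β.1 ⊂ α.1 → o.lt β α) :
    VertexCoverAlgebra.IsReducedGroebnerBasis (VertexCoverAlgebra.lexSharp G o)
        (VertexCoverAlgebra.toricIdeal K hG)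
        ({g | ∃ α β : VertexCoverAlgebra.coverLattice G, α.1 ≠ Finset.univ ∧
            β ∈ VertexCoverAlgebra.upperNeighbours α ∧
            g = VertexCoverAlgebra.xu K α β - VertexCoverAlgebra.yu K α β} ∪
          {g | ∃ α β : VertexCoverAlgebra.coverLattice G, ¬ α.1 ⊆ β.1 ∧ ¬ β.1 ⊆ α.1 ∧
            g = VertexCoverAlgebra.varU K α * VertexCoverAlgebra.varU K β -
              VertexCoverAlgebra.varU K (VertexCoverAlgebra.unionL hG α β) *
                VertexCoverAlgebra.varU K (VertexCoverAlgebra.interL hG α β)}) ∧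
      (∀ α β : VertexCoverAlgebra.coverLattice G, α.1 ≠ Finset.univ →
        β ∈ VertexCoverAlgebra.upperNeighbours α →
        (VertexCoverAlgebra.lexSharp G o).leadingTerm
            (VertexCoverAlgebra.xu K α β - VertexCoverAlgebra.yu K α β) =
          VertexCoverAlgebra.xu K α β) ∧
      (∀ α β : VertexCoverAlgebra.coverLattice G, ¬ α.1 ⊆ β.1 → ¬ β.1 ⊆ α.1 →
        (VertexCoverAlgebra.lexSharp G o).leadingTerm
            (VertexCoverAlgebra.varU K α * VertexCoverAlgebra.varU K β -
              VertexCoverAlgebra.varU K (VertexCoverAlgebra.unionL hG α β) *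
                VertexCoverAlgebra.varU K (VertexCoverAlgebra.interL hG α β)) =
          VertexCoverAlgebra.varU K α * VertexCoverAlgebra.varU K β) := by
  refine ⟨VertexCoverAlgebra.image_moves K hG ▸
    VertexCoverAlgebra.isReducedGroebnerBasis_moves K hG o ho,
    fun α β _ h => ?_, fun α β h1 h2 => ?_⟩
  · rw [VertexCoverAlgebra.xu_eq, VertexCoverAlgebra.yu_eq,
      VertexCoverAlgebra.leadingTerm_binomial _ (VertexCoverAlgebra.expYU_lt_expXU o (CovBy.lt h))]
  · rw [VertexCoverAlgebra.varU_mul_varU, VertexCoverAlgebra.varU_mul_varU,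
      VertexCoverAlgebra.leadingTerm_binomial _ (VertexCoverAlgebra.expUU_lt_expUU hG o ho h1 h2)]
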